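/- Let $d\ge 1$, let $\mathbf n=(n_1,\dots,n_d)$ be a tuple of positive integers, let $\rho\in[d]=\{1,\dots,d\}$ and let $D\subseteq[d]^2$. Let $\mathcal T_\rho(\mathbf n)$ be the set of rooted trees (acyclic connected graphs with a distinguished root vertex) with vertex set $\{(t,i) : t\in[d],\ i\in[n_t]\}$ whose root is of the form $(\rho,i)$. The vertex $(t,i)$ is said to have type $t$; the edges are oriented toward the root, that is, from child to parent, and an edge going from a vertex of type $s$ to a vertex of type $t$ is said to have type $(s,t)$. A tree is called injective if every vertex has at most one child of each type, and embedded in $D$ if the type of every edge belongs to $D$. Let $\mathrm{Cay}_d^{\rho}$ be the set of trees with vertex set $[d]$ rooted at the vertex $\rho$, with edges oriented toward the root; for such a tree $A$ we write $(s,t)\in A$ if the oriented edge $(s,t)$ belongs to $A$, and $A\subseteq D$ if all its oriented edges belong to $D$. Put $D(s)=\{t\in[d] : (s,t)\in D\}$, and let $\delta_{s,\rho}$ be the Kronecker delta. Then the number of injective trees in $\mathcal T_\rho(\mathbf n)$ that are embedded in $D$ is $$\left(\prod_{s\in[d]}\binom{\delta_{s,\rho}-1+\sum_{t\in D(s)}n_t}{n_s-1}\,(n_s-1)!\right)\times\sum_{A\in\mathrm{Cay}_d^{\rho},\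 A\subseteq D}\ \prod_{(s,t)\in A}n_t ,$$ where $\binom{x}{k}=x(x-1)\cdots(x-k+1)/k!$ for every integer $x$ and every integer $k\ge 0$. -/

import Mathlib

/-- A rooted tree with vertex set `V` (vertices are labeled, so two rooted trees are equal when they
have the same edges and the same root). -/
@[ext] structure RootedLabeledTree (V : Type*) where
  graph : SimpleGraph V
  isTree : graph.IsTree
  root : V

namespace RootedLabeledTree

instance {V : Type*} [Finite V] : Finite (RootedLabeledTree V) :=
  Finite.of_injective (fun T : RootedLabeledTree V => (T.graph, T.root)) (by
    intro S T h
    simp only [Prod.mk.injEq] at h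
    exact RootedLabeledTree.ext h.1 h.2)

noncomputable instance {V : Type*} [Finite V] : Fintype (RootedLabeledTree V) := Fintype.ofFinite _

/-- Edges are oriented toward the root: `T.IsChild u v` says that `(u, v)` is an oriented edge of
`T`, going from the child `u` to its parent `v` (`u` and `v` are adjacent, and `v` is the one of
the two that is closer to the root). -/
def IsChild {V : Type*} (T : RootedLabeledTree V) (u v : V) : Prop :=
  T.graph.Adj u v ∧ T.graph.dist u T.root = T.graph.dist v T.root + 1

open Classical in
/-- The finite set of oriented edges `(u, v)` of a rooted tree. -/
noncomputable def edges {V : Type*} [Fintype V] (T : RootedLabeledTree V) : Finset (V × V) :=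
  Finset.univ.filter fun e => T.IsChild e.1 e.2

end RootedLabeledTree

/-- The vertices `(t, i)`, of type `t` and label `i`, where `t ∈ [d]` and `i ∈ [n_t]`. -/
abbrev TypedVertex {d : ℕ} (n : Fin d → ℕ) : Type := Σ t : Fin d, Fin (n t)

/-- The rooted multitype Cayley trees of profile `n` whose root vertex has type `ρ`. -/
def multitypeTrees {d : ℕ} (ρ : Fin d) (n : Fin d → ℕ) : Set (RootedLabeledTree (TypedVertex n)) :=
  {T | T.root.1 = ρ}

/-- The number of children of type `s` of the vertex `v`. -/
noncomputable def childCount {d : ℕ} {n : Fin d → ℕ} (T : RootedLabeledTree (TypedVertex n))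
    (s : Fin d) (v : TypedVertex n) : ℕ :=
  {u : TypedVertex n | u.1 = s ∧ T.IsChild u v}.ncard

/-- A multitype tree is injective if every vertex has at most one child of each type. -/
def IsInjectiveTree {d : ℕ} {n : Fin d → ℕ} (T : RootedLabeledTree (TypedVertex n)) : Prop :=
  ∀ (v : TypedVertex n) (s : Fin d), childCount T s v ≤ 1

/-- A multitype tree is embedded in `D` if the type of every oriented edge belongs to `D`. -/
def IsEmbeddedIn {d : ℕ} {n : Fin d → ℕ} (T : RootedLabeledTree (TypedVertex n))
    (D : Finset (Fin d × Fin d)) : Prop :=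
  ∀ u v : TypedVertex n, T.IsChild u v → (u.1, v.1) ∈ D

/-- The injective trees embedded in `D`, of profile `n`, with root of type `ρ`. -/
def injectiveEmbeddedTrees {d : ℕ} (ρ : Fin d) (D : Finset (Fin d × Fin d)) (n : Fin d → ℕ) :
    Set (RootedLabeledTree (TypedVertex n)) :=
  {T | T ∈ multitypeTrees ρ n ∧ IsInjectiveTree T ∧ IsEmbeddedIn T D}

open Classical in
/-- The (unitype) Cayley trees with vertex set `[d]` rooted at the vertex `ρ`. -/
noncomputable def cayleyTrees {d : ℕ} (ρ : Fin d) : Finset (RootedLabeledTree (Fin d)) :=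
  Finset.univ.filter fun A => A.root = ρ

/-! A rooted tree is encoded by its parent map, with `none` at the root. Injectivity of the tree
says that `u ↦ (u.1, f u)` is injective; embeddedness and the root type say that `f u` lies in a set
`E s` depending only on the type `s` of `u`.

Give an arc from a vertex of type `s` to `o` a variable `x s o`. The directed matrix-tree theorem
turns the sum over acyclic maps into a Laplacian determinant. As rows of one type share their
weights, this determinant reduces to one indexed by types (`sum_acyclic_typed_eq`): each `s`
contributes `(∑ o, x s o) ^ (n s - 1)`, times a sum over acyclic maps on types.

Injective maps give exactly the squarefree monomials. Extracting these coefficients within `E`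
(`card_injective_acyclic`) leaves, for each `s`, one parent of prescribed type and `n s - 1` further
distinct parents in `E s`: a falling factorial of `|E s| - 1`. The prescribed choices add up to the
sum over Cayley trees. -/

/-! ### Acyclic parent maps -/

/-- A parent map `f : V → Option V` is acyclic if iterating it from any vertex reaches `none`. -/
def IsAcyclicParentMap {V : Type*} (f : V → Option V) : Prop :=
  WellFounded fun v u => f u = some v

theorem IsAcyclicParentMap.exists_depth {V : Type*} {f : V → Option V}
    (hf : IsAcyclicParentMap f) :
    ∃ h : V → ℕ, (∀ u, f u = none → h u = 0) ∧ ∀ u v, f u = some v → h u = h v + 1 := by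
  have key : ∀ u, ∀ (F : ∀ v, f u = some v → ℕ), ∃ k : ℕ, (f u = none → k = 0) ∧
      ∀ v (hv : f u = some v), k = F v hv + 1 := by
    intro u F
    obtain hu | ⟨v, hu⟩ : f u = none ∨ ∃ v, f u = some v := by cases f u <;> simp
    · exact ⟨0, fun _ => rfl, fun v hv => by simp [hu] at hv⟩
    · refine ⟨F v hu + 1, fun h => by simp [hu] at h, fun w hw => ?_⟩
      obtain rfl : v = w := by simpa [hu] using hw
      rfl
  choose G hG0 hG1 using key
  refine ⟨hf.fix G, fun u hu => ?_, fun u v hv => ?_⟩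
  · rw [hf.fix_eq]
    exact hG0 u _ hu
  · conv_lhs => rw [hf.fix_eq]
    exact hG1 u _ v hv

/-! ### The directed matrix-tree theorem and a determinant reduction -/

namespace Matrix

variable {V R : Type*} [Fintype V] [DecidableEq V] [CommRing R]

/-- The Laplacian matrix of a parent map. -/
def parentMapLaplacian (R : Type*) [CommRing R] (f : V → Option V) : Matrix V V R :=
  fun u => Pi.single u 1 - (f u).elim 0 fun v => Pi.single v 1

/-- Parents have smaller depth, so grading by depth makes the matrix block triangular with identity
diagonal blocks. -/
theorem det_parentMapLaplacian_of_isAcyclic {f : V → Option V} (hf : IsAcyclicParentMap f) :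
    (parentMapLaplacian R f).det = 1 := by
  obtain ⟨h, -, h1⟩ := hf.exists_depth
  have hM : (parentMapLaplacian R f).BlockTriangular fun u => OrderDual.toDual (h u) := by
    intro i j hij
    have hij' : h i < h j := hij
    have hne : j ≠ i := by rintro rfl; exact lt_irrefl _ hij'
    rcases hi : f i with _ | v
    · simp [parentMapLaplacian, hi, hne]
    · have hv := h1 i v hi
      have : j ≠ v := by rintro rfl; omega
      simp [parentMapLaplacian, hi, hne, this]
  rw [hM.det]
  refine Finset.prod_eq_one fun k _ => ?_
  convert det_one (n := {a // OrderDual.toDual (h a) = k}) (R := R)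
  ext ⟨i, hi⟩ ⟨j, hj⟩
  have hij : h i = h j := OrderDual.toDual.injective (hi.trans hj.symm)
  rcases hfi : f i with _ | v
  · simp [parentMapLaplacian, toSquareBlock_def, hfi, one_apply, Pi.single_apply, eq_comm]
  · have hv := h1 i v hfi
    have : j ≠ v := by rintro rfl; omega
    simp [parentMapLaplacian, toSquareBlock_def, hfi, this, one_apply, Pi.single_apply, eq_comm]

/-- The indicator of the vertices that never reach `none` is a nonzero kernel vector: such a vertex
and its parent are inaccessible together. Working over `ℤ` lets a kernel vector force the
determinant to vanish; the general ring follows by casting. -/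
theorem det_parentMapLaplacian_of_not_isAcyclic {f : V → Option V} (hf : ¬ IsAcyclicParentMap f) :
    (parentMapLaplacian ℤ f).det = 0 := by
  classical
  let r : V → V → Prop := fun v u => f u = some v
  obtain ⟨x, hx⟩ : ∃ x, ¬ Acc r x := by
    by_contra! H
    exact hf ⟨H⟩
  refine exists_mulVec_eq_zero_iff.mp ⟨fun u => if Acc r u then 0 else 1, ?_, ?_⟩
  · intro h0
    simpa [hx] using congrFun h0 x
  · ext u
    have hu : Acc r u ↔ ∀ v, f u = some v → Acc r v := ⟨fun h v hv => h.inv hv, fun h => ⟨u, h⟩⟩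
    rcases hfu : f u with _ | v
    · have : Acc r u := hu.mpr fun v hv => by simp [hfu] at hv
      simp [mulVec, parentMapLaplacian, hfu, this]
    · have : Acc r u ↔ Acc r v := by simp [hu, hfu]
      change (Pi.single u 1 - (f u).elim 0 fun v => Pi.single v 1) ⬝ᵥ _ = 0
      simp [hfu, this, sub_dotProduct]

omit [Fintype V] in
theorem map_parentMapLaplacian (f : V → Option V) :
    (parentMapLaplacian ℤ f).map (Int.cast : ℤ → R) = parentMapLaplacian R f := by
  ext u v
  rcases hfu : f u with _ | w <;> simp [parentMapLaplacian, hfu, Pi.single_apply]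

open Classical in
theorem det_parentMapLaplacian (f : V → Option V) :
    (parentMapLaplacian R f).det = if IsAcyclicParentMap f then 1 else 0 := by
  split_ifs with hf
  · exact det_parentMapLaplacian_of_isAcyclic hf
  · rw [← map_parentMapLaplacian]
    have := (Int.castRingHom R).map_det (parentMapLaplacian ℤ f)
    rw [det_parentMapLaplacian_of_not_isAcyclic hf, map_zero] at this
    exact this.symm

open Classical in
/-- The directed matrix-tree theorem: the determinant of the weighted Laplacian,
where `none` is the root, enumerates the acyclic parent maps. -/
theorem det_laplacian_eq_sum_acyclic (w : V → Option V → R) :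
    (diagonal (fun u => ∑ o, w u o) - of fun u v => w u (some v)).det =
      ∑ f : V → Option V with IsAcyclicParentMap f, ∏ u, w u (f u) := by
  -- Each row is a weighted sum over the possible parents of its vertex, so multilinearity expands
  -- the determinant over all parent maps.
  have hrow : (diagonal (fun u => ∑ o, w u o) - of fun u v => w u (some v)) =
      fun u => ∑ o : Option V, w u o •
        ((Pi.single u 1 : V → R) - o.elim 0 fun v => Pi.single v 1) := by
    ext u v
    simp only [sub_apply, diagonal_apply, of_apply, Finset.sum_apply, Pi.smul_apply, Pi.sub_apply,
      smul_eq_mul, mul_sub, Finset.sum_sub_distrib]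
    congr 1
    · simp [Pi.single_apply, eq_comm]
    · simp [Fintype.sum_option, Pi.single_apply]
  rw [hrow]
  change detRowAlternating.toMultilinearMap _ = _
  rw [MultilinearMap.map_sum, Finset.sum_filter]
  refine Finset.sum_congr rfl fun f _ => ?_
  rw [MultilinearMap.map_smul_univ]
  have := det_parentMapLaplacian (R := R) f
  change detRowAlternating.toMultilinearMap _ = _ at this
  unfold parentMapLaplacian at this
  rw [this]
  simp

/-- If `P * B = B * Q`, the determinants of `P - B * C` and `Q - C * B` agree up to the
determinants of `P` and `Q`. -/
theorem det_sub_mul_mul_det_of_intertwine {m n : Type*} [Fintype m] [DecidableEq m] [Fintype n]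
    [DecidableEq n] {P : Matrix m m R} {Q : Matrix n n R} {B : Matrix m n R} (C : Matrix n m R)
    (h : P * B = B * Q) : (P - B * C).det * Q.det = P.det * (Q - C * B).det := by
  -- Multiply `[[P, B], [C, 1]]` by `[[1, -B], [0, Q]]`: the intertwining relation kills the upper
  -- right block.
  rw [← det_fromBlocks_one₂₂ P B C]
  have h1 : (fromBlocks 1 (-B) 0 Q).det = Q.det := by rw [det_fromBlocks_zero₂₁, det_one, one_mul]
  rw [← h1, ← det_mul, fromBlocks_multiply, ← det_fromBlocks_zero₁₂ P C]
  congr 2 <;> simp [h]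
  abel

end Matrix

/-! ### Squarefree coefficient extraction -/

namespace MvPolynomial

variable {σ : Type*} [DecidableEq σ]

/-- The sum of the coefficients of the squarefree monomials whose variables lie in `E`. -/
noncomputable def squarefreeCoeffSum (E : Finset σ) : MvPolynomial σ ℤ →ₗ[ℤ] ℤ :=
  open Classical in
  (basisMonomials σ ℤ).constr ℤ fun m => if (∀ e, m e ≤ 1) ∧ m.support ⊆ E then 1 else 0

open Classical in
theorem squarefreeCoeffSum_prod_X {ι : Type*} [Fintype ι] (E : Finset σ) (h : ι → σ) :
    squarefreeCoeffSum E (∏ i, X (h i)) =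
      if Function.Injective h ∧ ∀ i, h i ∈ E then 1 else 0 := by
  have hmon : (∏ i, X (h i) : MvPolynomial σ ℤ) =
      basisMonomials σ ℤ (∑ i, Finsupp.single (h i) 1) := by
    rw [coe_basisMonomials]
    exact (monomial_sum_one _ _).symm
  have hcard : ∀ e, (∑ i, Finsupp.single (h i) 1 : σ →₀ ℕ) e =
      (Finset.univ.filter fun i => h i = e).card := by
    intro e
    simp [Finsupp.finsetSum_apply, Finsupp.single_apply]
  rw [hmon, squarefreeCoeffSum, Module.Basis.constr_basis]
  refine if_congr (and_congr ?_ ?_) rfl rfl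
  · simp only [hcard, Finset.card_le_one, Finset.mem_filter, Finset.mem_univ, true_and]
    exact ⟨fun H a b hab => H _ a hab b rfl, fun H e a ha b hb => H (ha.trans hb.symm)⟩
  · constructor
    · intro H i
      refine H (Finsupp.mem_support_iff.mpr ?_)
      rw [hcard, ← Nat.pos_iff_ne_zero, Finset.card_pos]
      exact ⟨i, by simp⟩
    · intro H e he
      rw [Finsupp.mem_support_iff, hcard, ← Nat.pos_iff_ne_zero, Finset.card_pos] at he
      obtain ⟨i, hi⟩ := he
      obtain rfl : h i = e := by simpa using hi
      exact H i

end MvPolynomial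

open Classical in
/-- The number of injections `Option (Fin k) → E` sending `none` into `T`. -/
theorem card_injective_option {W : Type*} [Fintype W] (E T : Finset W) (k : ℕ) :
    (Finset.univ.filter fun h : Option (Fin k) → W =>
      h none ∈ T ∧ Function.Injective h ∧ ∀ j, h j ∈ E).card =
      (E ∩ T).card * (E.card - 1).descFactorial k := by
  have e : {h : Option (Fin k) → W // h none ∈ T ∧ Function.Injective h ∧ ∀ j, h j ∈ E} ≃
      Σ a : {a // a ∈ E ∩ T}, Fin k ↪ {x // x ∈ E.erase a.1} :=
    { toFun := fun h => ⟨⟨h.1 none, Finset.mem_inter.mpr ⟨h.2.2.2 none, h.2.1⟩⟩,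
        ⟨fun j => ⟨h.1 (some j), Finset.mem_erase.mpr
          ⟨fun hh => by simpa using h.2.2.1 hh, h.2.2.2 _⟩⟩, fun i j hij => by
            simpa using h.2.2.1 (congrArg Subtype.val hij)⟩⟩
      invFun := fun p => ⟨fun j => j.elim p.1.1 fun i => (p.2 i).1,
        (Finset.mem_inter.mp p.1.2).2, by
          rintro (_ | i) (_ | j) hij
          · rfl
          · exact absurd hij.symm (Finset.mem_erase.mp (p.2 j).2).1
          · exact absurd hij (Finset.mem_erase.mp (p.2 i).2).1
          · exact congrArg some (p.2.injective (Subtype.ext hij)), by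
          rintro (_ | i)
          · exact (Finset.mem_inter.mp p.1.2).1
          · exact (Finset.mem_erase.mp (p.2 i).2).2⟩
      left_inv := fun h => Subtype.ext (funext fun j => by cases j <;> rfl)
      right_inv := fun p => rfl }
  rw [← Fintype.card_subtype, Fintype.card_congr e, Fintype.card_sigma]
  have : ∀ a : {a // a ∈ E ∩ T}, Fintype.card (Fin k ↪ {x // x ∈ E.erase a.1}) =
      (E.card - 1).descFactorial k := by
    intro a
    rw [Fintype.card_embedding_eq, Fintype.card_coe, Fintype.card_fin,
      Finset.card_erase_of_mem (Finset.mem_inter.mp a.2).1]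
  rw [Finset.sum_congr rfl fun a _ => this a]
  simp

/-! ### Counting acyclic parent maps on typed vertices -/

section TypedParentMaps

variable {S : Type*} [Fintype S] [DecidableEq S] {n : S → ℕ}

open Classical in
/-- When the weight of an arc `u → o` depends on `u` only through its type, the weighted count of
acyclic parent maps reduces to the one of acyclic parent maps on the types. -/
theorem sum_acyclic_typed_eq {R : Type*} [CommRing R] [IsDomain R] (hn : ∀ s, 0 < n s)
    (x : S → Option (Σ s, Fin (n s)) → R) (hx : ∀ s, ∑ o, x s o ≠ 0) :
    ∑ f : (Σ s, Fin (n s)) → Option (Σ s, Fin (n s)) with IsAcyclicParentMap f,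
        ∏ u, x u.1 (f u) =
      (∏ s, (∑ o, x s o) ^ (n s - 1)) *
        ∑ F : S → Option S with IsAcyclicParentMap F,
          ∏ s, ∑ o with o.map Sigma.fst = F s, x s o := by
  let P : Matrix (Σ s, Fin (n s)) (Σ s, Fin (n s)) R := .diagonal fun u => ∑ o, x u.1 o
  let Q : Matrix S S R := .diagonal fun s => ∑ o, x s o
  let B : Matrix (Σ s, Fin (n s)) S R := .of fun u s => if u.1 = s then 1 else 0
  let C : Matrix S (Σ s, Fin (n s)) R := .of fun s v => x s (some v)
  have hPB : P * B = B * Q := by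
    ext u s
    simp only [P, B, Q, Matrix.diagonal_mul, Matrix.mul_diagonal, Matrix.of_apply]
    split_ifs with h
    · rw [h, mul_comm]
    · simp
  have hBC : B * C = .of fun u v => x u.1 (some v) := by
    ext u v
    simp [B, C, Matrix.mul_apply]
  have hCB : C * B = .of fun s t => ∑ o with o.map Sigma.fst = some t, x s o := by
    ext s t
    simp [B, C, Matrix.mul_apply, Finset.sum_filter, Fintype.sum_option, -Option.map_eq_some_iff]
  have hQ : Q = .diagonal fun s => ∑ o', ∑ o with o.map Sigma.fst = o', x s o := by
    refine congrArg Matrix.diagonal (funext fun s => ?_)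
    exact (Finset.sum_fiberwise Finset.univ _ _).symm
  have hdetQ : Q.det = ∏ s, ∑ o, x s o := Matrix.det_diagonal
  have hdetP : P.det = (∏ s, (∑ o, x s o) ^ (n s - 1)) * ∏ s, ∑ o, x s o := by
    rw [Matrix.det_diagonal, Fintype.prod_sigma, ← Finset.prod_mul_distrib]
    refine Finset.prod_congr rfl fun s _ => ?_
    rw [pow_sub_one_mul (hn s).ne']
    simp
  have h := Matrix.det_sub_mul_mul_det_of_intertwine C hPB
  -- `P.det` contains `Q.det` as a factor, which is cancelled from both sides in the domain `R`.
  have hne : Q.det ≠ 0 := hdetQ ▸ Finset.prod_ne_zero_iff.mpr fun s _ => hx s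
  rw [← Matrix.det_laplacian_eq_sum_acyclic
    fun (u : Σ s, Fin (n s)) o => x u.1 o, ← hBC]
  rw [← Matrix.det_laplacian_eq_sum_acyclic
    fun (s : S) o' => ∑ o with o.map Sigma.fst = o', x s o, ← hCB, ← hQ]
  refine mul_right_cancel₀ hne (h.trans ?_)
  rw [hdetP, hdetQ]
  ring

open Classical in
/-- The number of choice functions which are injective on each type, with values in `E`. -/
theorem card_typed_injective (E T : S → Finset (Option (Σ s, Fin (n s)))) :
    ((Fintype.piFinset fun p : Σ s, Option (Fin (n s - 1)) =>
        if p.2 = none then T p.1 else Finset.univ).filter fun g =>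
      Function.Injective (fun p => (p.1, g p)) ∧ ∀ p, g p ∈ E p.1).card =
      ∏ s, ((E s ∩ T s).card * ((E s).card - 1).descFactorial (n s - 1)) := by
  have hS : ∀ s, (E s ∩ T s).card * ((E s).card - 1).descFactorial (n s - 1) =
      (Finset.univ.filter fun h : Option (Fin (n s - 1)) → Option (Σ s, Fin (n s)) =>
        h none ∈ T s ∧ Function.Injective h ∧ ∀ j, h j ∈ E s).card := by
    intro s
    convert (card_injective_option (E s) (T s) (n s - 1)).symm
  rw [Finset.prod_congr rfl fun s _ => hS s, ← Fintype.card_piFinset]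
  refine Finset.card_equiv (Equiv.piCurry
    fun (s : S) (_ : Option (Fin (n s - 1))) => Option (Σ s, Fin (n s))) fun g => ?_
  simp only [Finset.mem_filter, Fintype.mem_piFinset, Finset.mem_univ, true_and]
  constructor
  · rintro ⟨hT, hinj, hE⟩ s
    refine ⟨by simpa [Sigma.curry] using hT ⟨s, none⟩, fun i j hij => ?_, fun j => hE ⟨s, j⟩⟩
    simpa using hinj (a₁ := ⟨s, i⟩) (a₂ := ⟨s, j⟩) (Prod.ext rfl hij)
  · intro H
    refine ⟨?_, ?_, fun p => (H p.1).2.2 p.2⟩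
    · rintro ⟨s, j⟩
      rcases j with _ | j
      · simpa [Sigma.curry] using (H s).1
      · simp
    · rintro ⟨s, i⟩ ⟨t, j⟩ hij
      obtain ⟨hst, hv⟩ := Prod.ext_iff.mp hij
      obtain rfl : s = t := hst
      rw [(H s).2.1 hv]

open Classical in
theorem card_injective_acyclic (hn : ∀ s, 0 < n s) (E : S → Finset (Option (Σ s, Fin (n s)))) :
    (Finset.univ.filter fun f : (Σ s, Fin (n s)) → Option (Σ s, Fin (n s)) =>
      IsAcyclicParentMap f ∧ Function.Injective (fun u => (u.1, f u)) ∧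
        ∀ u, f u ∈ E u.1).card =
      ∑ F : S → Option S with IsAcyclicParentMap F,
        ∏ s, (((E s).filter fun o => o.map Sigma.fst = F s).card *
          ((E s).card - 1).descFactorial (n s - 1)) := by
  let E' : Finset (S × Option (Σ s, Fin (n s))) := Finset.univ.filter fun e => e.2 ∈ E e.1
  let x : S → Option (Σ s, Fin (n s)) → MvPolynomial (S × Option (Σ s, Fin (n s))) ℤ :=
    fun s o => .X (s, o)
  have hx : ∀ s, ∑ o, x s o ≠ 0 := by
    intro s h0
    -- At this point only the variable with `o = none` survives, so the sum evaluates to 1.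
    have := congrArg (MvPolynomial.eval fun e => if e.2 = none then (1 : ℤ) else 0) h0
    simp [x] at this
  have key := congrArg (MvPolynomial.squarefreeCoeffSum E') (sum_acyclic_typed_eq hn x hx)
  -- The index `none` selects from the factor constrained by `F s`; the indices `some j` select from
  -- the `n s - 1` unconstrained factors.
  have hprod : ∀ F : S → Option S,
      (∏ s, (∑ o, x s o) ^ (n s - 1)) * ∏ s, ∑ o with o.map Sigma.fst = F s, x s o =
        ∑ g ∈ Fintype.piFinset fun p : Σ s, Option (Fin (n s - 1)) =>
          if p.2 = none then Finset.univ.filter (fun o => o.map Sigma.fst = F p.1)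
            else Finset.univ, ∏ p, MvPolynomial.X (p.1, g p) := by
    intro F
    rw [← Finset.prod_univ_sum (f := fun (p : Σ s, Option (Fin (n s - 1))) o =>
      (MvPolynomial.X (p.1, o) : MvPolynomial (S × Option (Σ s, Fin (n s))) ℤ)),
      Fintype.prod_sigma, ← Finset.prod_mul_distrib]
    refine Finset.prod_congr rfl fun s _ => ?_
    rw [Fintype.prod_option, mul_comm]
    simp [x]
  simp only [Finset.mul_sum, hprod, map_sum] at key
  simp only [x, MvPolynomial.squarefreeCoeffSum_prod_X, E', Finset.mem_filter, Finset.mem_univ,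
    true_and, Finset.sum_boole, Finset.filter_filter] at key
  zify
  refine key.trans (Finset.sum_congr rfl fun F _ => ?_)
  have h := card_typed_injective E fun s => Finset.univ.filter fun o => o.map Sigma.fst = F s
  simp only [Finset.inter_filter, Finset.inter_univ] at h
  exact_mod_cast (by convert h)

end TypedParentMaps

theorem IsAcyclicParentMap.exists_eq_none {V : Type*} [Nonempty V] {f : V → Option V}
    (hf : IsAcyclicParentMap f) : ∃ u, f u = none := by
  obtain ⟨u, -, hu⟩ := hf.has_min Set.univ Set.univ_nonempty
  refine ⟨u, Option.eq_none_iff_forall_ne_some.mpr fun v hv => hu v trivial hv⟩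

/-! ### Rooted trees as acyclic parent maps -/

namespace RootedLabeledTree

variable {V : Type*} (T : RootedLabeledTree V)

/-- Each parent begins a shortest walk from `u` to the root, and paths in a tree are unique. -/
theorem IsChild.unique {T : RootedLabeledTree V} {u v w : V} (hv : T.IsChild u v)
    (hw : T.IsChild u w) : v = w := by
  obtain ⟨p, hp⟩ := T.isTree.connected.exists_walk_length_eq_dist v T.root
  obtain ⟨q, hq⟩ := T.isTree.connected.exists_walk_length_eq_dist w T.root
  have hp' : (SimpleGraph.Walk.cons hv.1 p).IsPath :=
    SimpleGraph.Walk.isPath_of_length_eq_dist _ (by simp [hp, hv.2])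
  have hq' : (SimpleGraph.Walk.cons hw.1 q).IsPath :=
    SimpleGraph.Walk.isPath_of_length_eq_dist _ (by simp [hq, hw.2])
  have := congrArg SimpleGraph.Walk.snd ((T.isTree.existsUnique_path u T.root).unique hp' hq')
  simpa using this

theorem exists_isChild {u : V} (hu : u ≠ T.root) : ∃ v, T.IsChild u v := by
  obtain ⟨p, hp⟩ := T.isTree.connected.exists_walk_length_eq_dist u T.root
  cases p with
  | nil => exact absurd rfl hu
  | @cons _ v _ h p =>
    refine ⟨v, h, ?_⟩
    have h1 := SimpleGraph.dist_le p
    have h2 := T.isTree.connected.dist_triangle (u := u) (v := v) (w := T.root)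
    rw [SimpleGraph.dist_eq_one_iff_adj.mpr h] at h2
    rw [SimpleGraph.Walk.length_cons] at hp
    omega

theorem adj_iff_isChild {u v : V} : T.graph.Adj u v ↔ T.IsChild u v ∨ T.IsChild v u := by
  refine ⟨fun h => ?_, fun h => h.elim (·.1) (·.1.symm)⟩
  have := T.isTree.dist_eq_dist_add_one_of_adj T.root h
  rw [SimpleGraph.dist_comm, SimpleGraph.dist_comm (v := v)] at this
  exact this.imp (⟨h, ·⟩) (⟨h.symm, ·⟩)

theorem not_isChild_root (v : V) : ¬ T.IsChild T.root v := by
  intro h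
  simpa using h.2

open Classical in
/-- The parent of each vertex, which is `none` for the root. -/
noncomputable def parentMap (u : V) : Option V :=
  if h : ∃ v, T.IsChild u v then some h.choose else none

theorem parentMap_eq_some {u v : V} : T.parentMap u = some v ↔ T.IsChild u v := by
  unfold parentMap
  split_ifs with h
  · rw [Option.some_inj]
    exact ⟨fun e => e ▸ h.choose_spec, fun hv => h.choose_spec.unique hv⟩
  · simpa using fun hv => h ⟨v, hv⟩

theorem parentMap_eq_none {u : V} : T.parentMap u = none ↔ u = T.root := by
  rw [Option.eq_none_iff_forall_ne_some]
  simp only [ne_eq, parentMap_eq_some]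
  constructor
  · intro h
    by_contra hu
    obtain ⟨v, hv⟩ := T.exists_isChild hu
    exact h v hv
  · rintro rfl
    exact T.not_isChild_root

theorem isAcyclicParentMap_parentMap : IsAcyclicParentMap T.parentMap := by
  refine Subrelation.wf (fun {v u} h => ?_) (measure fun u => T.graph.dist u T.root).wf
  have := (T.parentMap_eq_some.mp h).2
  change T.graph.dist v T.root < T.graph.dist u T.root
  omega

theorem parentMap_injective : Function.Injective (parentMap (V := V)) := by
  intro S T h
  refine RootedLabeledTree.ext (SimpleGraph.ext ?_) ?_
  · ext u v
    rw [adj_iff_isChild, adj_iff_isChild]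
    simp only [← parentMap_eq_some, h]
  · rw [← parentMap_eq_none, ← h, parentMap_eq_none]

theorem exists_parentMap_eq [Finite V] {f : V → Option V} (hf : IsAcyclicParentMap f) {r : V}
    (hr : ∀ u, f u = none ↔ u = r) : ∃ T : RootedLabeledTree V, T.root = r ∧ T.parentMap = f := by
  classical
  obtain ⟨h, h0, h1⟩ := hf.exists_depth
  let G : SimpleGraph V :=
    { Adj := fun u v => f u = some v ∨ f v = some u
      symm := ⟨fun _ _ => Or.symm⟩
      loopless := ⟨fun u hu => by
        have := h1 u u (hu.elim id id)
        omega⟩ }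
  have hwalk : ∀ u, ∃ p : G.Walk u r, p.length = h u := by
    intro u
    induction u using hf.induction with
    | _ u ih =>
      rcases hu : f u with _ | v
      · obtain rfl := (hr u).mp hu
        exact ⟨.nil, (h0 _ hu).symm⟩
      · obtain ⟨p, hp⟩ := ih v hu
        exact ⟨.cons (Or.inl hu) p, by simp [hp, h1 u v hu]⟩
  -- Depth changes by one along each edge, so it bounds the distance to `r` from below.
  have hle : ∀ u v (p : G.Walk u v), h u ≤ h v + p.length := by
    intro u v p
    induction p with
    | nil => simp
    | cons hadj p ih =>
      rw [SimpleGraph.Walk.length_cons]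
      rcases hadj with hadj | hadj <;> have := h1 _ _ hadj <;> omega
  have hconn : G.Connected :=
    { preconnected := fun u v => by
        obtain ⟨p, -⟩ := hwalk u
        obtain ⟨q, -⟩ := hwalk v
        exact ⟨p.append q.reverse⟩
      nonempty := ⟨r⟩ }
  have hdist : ∀ u, G.dist u r = h u := by
    intro u
    obtain ⟨p, hp⟩ := hwalk u
    obtain ⟨q, hq⟩ := hconn.exists_walk_length_eq_dist u r
    refine le_antisymm (hp ▸ SimpleGraph.dist_le p) ?_
    have := hle u r q
    rw [h0 r ((hr r).mpr rfl)] at this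
    omega
  have htree : G.IsTree := by
    have : Fintype V := Fintype.ofFinite V
    refine SimpleGraph.isTree_iff_connected_and_card.mpr ⟨hconn, le_antisymm ?_
      hconn.card_vert_le_card_edgeSet_add_one⟩
    -- Every edge joins a non-root vertex to its parent, giving at most `|V| - 1` edges; the default
    -- `r` is never used there.
    have hsub : G.edgeSet ⊆
        ↑((Finset.univ.erase r).image fun u => s(u, (f u).getD r)) := by
      intro e
      induction e using Sym2.ind with
      | _ u v =>
        have key : ∀ a b, f a = some b → s(a, b) ∈
            (Finset.univ.erase r).image fun u => s(u, (f u).getD r) := by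
          intro a b hab
          refine Finset.mem_image.mpr ⟨a, ?_, by simp [hab]⟩
          rw [Finset.mem_erase, ne_eq, ← hr, hab]
          simp
        rintro (hadj | hadj)
        · exact key u v hadj
        · exact Sym2.eq_swap ▸ key v u hadj
    have hcard := (Set.ncard_le_ncard hsub).trans
      ((Set.ncard_coe_finset _).trans_le Finset.card_image_le)
    rw [Finset.card_erase_of_mem (Finset.mem_univ r), Finset.card_univ] at hcard
    have hpos : 0 < Fintype.card V := Fintype.card_pos_iff.mpr ⟨r⟩
    rw [Nat.card_coe_set_eq, Nat.card_eq_fintype_card]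
    omega
  refine ⟨⟨G, htree, r⟩, rfl, ?_⟩
  ext u v
  rw [parentMap_eq_some]
  change ((f u = some v ∨ f v = some u) ∧ G.dist u r = G.dist v r + 1) ↔ _
  rw [hdist, hdist]
  constructor
  · rintro ⟨hadj | hadj, hd⟩
    · exact hadj
    · have := h1 _ _ hadj
      omega
  · exact fun huv => ⟨Or.inl huv, h1 u v huv⟩

theorem edges_subset_iff [Fintype V] {D : Finset (V × V)} :
    T.edges ⊆ D ↔ ∀ u v, T.parentMap u = some v → (u, v) ∈ D := by
  simp [edges, Finset.subset_iff, parentMap_eq_some]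

theorem prod_edges [Fintype V] {M : Type*} [CommMonoid M] (g : V → M) :
    ∏ e ∈ T.edges, g e.2 = ∏ u, (T.parentMap u).elim 1 g := by
  classical
  rw [edges, Finset.prod_filter, Fintype.prod_prod_type]
  refine Finset.prod_congr rfl fun u _ => ?_
  simp only [← parentMap_eq_some]
  rcases T.parentMap u with _ | v <;> simp

end RootedLabeledTree

/-! ### Injective embedded trees and the sum over Cayley trees -/

section InjectiveEmbedded

variable {d : ℕ} {n : Fin d → ℕ}

open Classical in
/-- The parents (or `none`, for the root) allowed for the vertices of type `s`. -/
noncomputable def allowedParents (n : Fin d → ℕ) (ρ : Fin d) (D : Finset (Fin d × Fin d))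
    (s : Fin d) : Finset (Option (TypedVertex n)) :=
  Finset.univ.filter fun o => o.elim (s = ρ) fun v => (s, v.1) ∈ D

theorem none_mem_allowedParents {ρ : Fin d} {D : Finset (Fin d × Fin d)} {s : Fin d} :
    none ∈ allowedParents n ρ D s ↔ s = ρ := by
  simp [allowedParents]

theorem some_mem_allowedParents {ρ : Fin d} {D : Finset (Fin d × Fin d)} {s : Fin d}
    {v : TypedVertex n} : some v ∈ allowedParents n ρ D s ↔ (s, v.1) ∈ D := by
  simp [allowedParents]

theorem card_allowedParents (ρ : Fin d) (D : Finset (Fin d × Fin d)) (s : Fin d) :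
    (allowedParents n ρ D s).card =
      (if s = ρ then 1 else 0) + ∑ t ∈ Finset.univ.filter (fun t : Fin d => (s, t) ∈ D), n t := by
  rw [allowedParents, Finset.card_filter, Fintype.sum_option, Fintype.sum_sigma, Finset.sum_filter]
  refine congrArg₂ (· + ·) (by by_cases h : s = ρ <;> simp [h]) (Finset.sum_congr rfl fun t _ => ?_)
  by_cases h : (s, t) ∈ D <;> simp [h]

open Classical in
theorem card_allowedParents_filter_type (ρ : Fin d) (D : Finset (Fin d × Fin d)) (s : Fin d)
    (o' : Option (Fin d)) :
    ((allowedParents n ρ D s).filter fun o => o.map Sigma.fst = o').card =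
      o'.elim (if s = ρ then 1 else 0) fun t => if (s, t) ∈ D then n t else 0 := by
  rcases o' with _ | t
  · simp [allowedParents, Finset.card_filter, Fintype.sum_option, -Finset.sum_boole,
      Finset.filter_filter, ite_and]
  · have : ∀ a : Fin d, (∑ _i : Fin (n a), if (s, a) ∈ D ∧ a = t then 1 else 0) =
        if a = t then if (s, t) ∈ D then n t else 0 else 0 := by
      intro a
      by_cases h : a = t
      · subst h
        simp
      · simp [h]
    simp [allowedParents, Finset.card_filter, Fintype.sum_option, -Finset.sum_boole,
      Finset.filter_filter, Fintype.sum_sigma, -Option.map_eq_some_iff, this]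

theorem isInjectiveTree_iff {T : RootedLabeledTree (TypedVertex n)} :
    IsInjectiveTree T ↔ Function.Injective fun u => (u.1, T.parentMap u) := by
  simp only [IsInjectiveTree, childCount, Set.ncard_le_one (Set.toFinite _), Set.mem_ofPred_eq,
    ← RootedLabeledTree.parentMap_eq_some]
  constructor
  · intro H u v huv
    obtain ⟨ht, hp⟩ := Prod.ext_iff.mp huv
    change u.1 = v.1 at ht
    change T.parentMap u = T.parentMap v at hp
    rcases hv : T.parentMap v with _ | w
    · rw [hv] at hp
      exact (T.parentMap_eq_none.mp hp).trans (T.parentMap_eq_none.mp hv).symm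
    · exact H w v.1 u ⟨ht, hp.trans hv⟩ v ⟨rfl, hv⟩
  · rintro H w s u ⟨hus, hu⟩ v ⟨hvs, hv⟩
    exact H (Prod.ext (hus.trans hvs.symm) (hu.trans hv.symm))

theorem forall_parentMap_mem_allowedParents_iff {ρ : Fin d} {D : Finset (Fin d × Fin d)}
    {T : RootedLabeledTree (TypedVertex n)} :
    (∀ u, T.parentMap u ∈ allowedParents n ρ D u.1) ↔ T.root.1 = ρ ∧ IsEmbeddedIn T D := by
  simp only [IsEmbeddedIn, ← RootedLabeledTree.parentMap_eq_some]
  constructor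
  · intro H
    refine ⟨?_, fun u v huv => ?_⟩
    · have := H T.root
      rwa [T.parentMap_eq_none.mpr rfl, none_mem_allowedParents] at this
    · have := H u
      rwa [huv, some_mem_allowedParents] at this
  · rintro ⟨hρ, H⟩ u
    rcases hu : T.parentMap u with _ | v
    · rw [none_mem_allowedParents, T.parentMap_eq_none.mp hu, hρ]
    · exact some_mem_allowedParents.mpr (H u v hu)

open Classical in
theorem ncard_injectiveEmbeddedTrees_eq (hn : ∀ t, 0 < n t) (ρ : Fin d)
    (D : Finset (Fin d × Fin d)) :
    (injectiveEmbeddedTrees ρ D n).ncard =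
      (Finset.univ.filter fun f : TypedVertex n → Option (TypedVertex n) =>
        IsAcyclicParentMap f ∧ Function.Injective (fun u => (u.1, f u)) ∧
          ∀ u, f u ∈ allowedParents n ρ D u.1).card := by
  rw [← Set.ncard_image_of_injective _ RootedLabeledTree.parentMap_injective,
    ← Set.ncard_coe_finset]
  congr 1
  ext f
  simp only [Set.mem_image, Finset.coe_filter, Finset.mem_univ, true_and, Set.mem_ofPred_eq]
  constructor
  · rintro ⟨T, ⟨hρ, hinj, hD⟩, rfl⟩
    exact ⟨T.isAcyclicParentMap_parentMap, isInjectiveTree_iff.mp hinj,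
      forall_parentMap_mem_allowedParents_iff.mpr ⟨hρ, hD⟩⟩
  · rintro ⟨hf, hinj, hE⟩
    have : Nonempty (TypedVertex n) := ⟨⟨ρ, ⟨0, hn ρ⟩⟩⟩
    have hρ : ∀ u, f u = none → u.1 = ρ := fun u hu =>
      none_mem_allowedParents.mp (hu ▸ hE u)
    obtain ⟨r, hr⟩ := hf.exists_eq_none
    -- An acyclic map may have several roots; here all have type `ρ` and value `none`, so
    -- injectivity leaves only one.
    obtain ⟨T, -, rfl⟩ := RootedLabeledTree.exists_parentMap_eq hf (r := r) fun u =>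
      ⟨fun hu => hinj (Prod.ext ((hρ u hu).trans (hρ r hr).symm) (hu.trans hr.symm)),
        fun hu => hu ▸ hr⟩
    obtain ⟨hroot, hD⟩ := forall_parentMap_mem_allowedParents_iff.mp hE
    exact ⟨T, ⟨hroot, isInjectiveTree_iff.mpr hinj, hD⟩, rfl⟩

open Classical in
theorem sum_acyclic_eq_sum_cayleyTrees (ρ : Fin d) (D : Finset (Fin d × Fin d)) :
    ∑ F : Fin d → Option (Fin d) with IsAcyclicParentMap F, ∏ s,
        (F s).elim (if s = ρ then 1 else 0) (fun t => if (s, t) ∈ D then n t else 0) =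
      ∑ A ∈ (cayleyTrees ρ).filter (fun A => A.edges ⊆ D), ∏ e ∈ A.edges, n e.2 := by
  symm
  refine Finset.sum_of_injOn RootedLabeledTree.parentMap
    RootedLabeledTree.parentMap_injective.injOn (fun A _ => ?_) (fun F hF hF' => ?_)
    fun A hA => ?_
  · simpa using A.isAcyclicParentMap_parentMap
  -- A nonzero term allows `none` only at `ρ` and arcs only in `D`, hence comes from a Cayley tree.
  · by_contra hne
    rw [← ne_eq, Finset.prod_ne_zero_iff] at hne
    have hacyc : IsAcyclicParentMap F := by simpa using hF
    have hnone : ∀ s, F s = none → s = ρ := by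
      intro s hs
      by_contra h
      simpa [hs, h] using hne s
    have hsome : ∀ s t, F s = some t → (s, t) ∈ D := by
      intro s t hs
      by_contra h
      simpa [hs, h] using hne s
    have : Nonempty (Fin d) := ⟨ρ⟩
    obtain ⟨r, hr⟩ := hacyc.exists_eq_none
    obtain rfl := hnone r hr
    obtain ⟨A, hA, rfl⟩ := RootedLabeledTree.exists_parentMap_eq hacyc (r := r) fun u =>
      ⟨hnone u, fun hu => hu ▸ hr⟩
    exact hF' ⟨A, by simpa [cayleyTrees, hA, RootedLabeledTree.edges_subset_iff] using hsome, rfl⟩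
  · simp only [cayleyTrees, Finset.mem_filter, Finset.mem_univ, true_and,
      RootedLabeledTree.edges_subset_iff] at hA
    rw [RootedLabeledTree.prod_edges]
    refine Finset.prod_congr rfl fun s _ => ?_
    rcases hs : A.parentMap s with _ | t
    · rw [A.parentMap_eq_none, hA.1] at hs
      simp [hs]
    · simp [hA.2 s t hs]

theorem ncard_injectiveEmbeddedTrees (hn : ∀ t, 0 < n t) (ρ : Fin d)
    (D : Finset (Fin d × Fin d)) :
    (injectiveEmbeddedTrees ρ D n).ncard =
      (∏ s, ((allowedParents n ρ D s).card - 1).descFactorial (n s - 1)) *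
        ∑ A ∈ (cayleyTrees ρ).filter (fun A => A.edges ⊆ D), ∏ e ∈ A.edges, n e.2 := by
  classical
  rw [ncard_injectiveEmbeddedTrees_eq hn, card_injective_acyclic hn,
    ← sum_acyclic_eq_sum_cayleyTrees, Finset.mul_sum]
  refine Finset.sum_congr rfl fun F _ => ?_
  rw [← Finset.prod_mul_distrib]
  refine Finset.prod_congr rfl fun s _ => ?_
  rw [mul_comm]
  congr 1
  convert card_allowedParents_filter_type ρ D s (F s)

theorem allowedParents_nonempty (hn : ∀ t, 0 < n t) {ρ : Fin d} {D : Finset (Fin d × Fin d)}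
    {A : RootedLabeledTree (Fin d)} (hA : A.root = ρ) (hAD : A.edges ⊆ D) (s : Fin d) :
    (allowedParents n ρ D s).Nonempty := by
  rcases hs : A.parentMap s with _ | t
  · exact ⟨none, none_mem_allowedParents.mpr ((A.parentMap_eq_none.mp hs).trans hA)⟩
  · exact ⟨some ⟨t, 0, hn t⟩, some_mem_allowedParents.mpr
      (RootedLabeledTree.edges_subset_iff A |>.mp hAD s t hs)⟩

end InjectiveEmbedded

theorem mainTheorem10 {d : ℕ} (n : Fin d → ℕ) (hn : ∀ t, 0 < n t) (ρ : Fin d)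
    (D : Finset (Fin d × Fin d)) :
    ((injectiveEmbeddedTrees ρ D n).ncard : ℤ) =
      (∏ s : Fin d,
        Ring.choose ((if s = ρ then 1 else 0) - 1 +
            ∑ t ∈ Finset.univ.filter (fun t : Fin d => (s, t) ∈ D), (n t : ℤ)) (n s - 1) *
          ((n s - 1).factorial : ℤ)) *
      ∑ A ∈ (cayleyTrees ρ).filter (fun A => A.edges ⊆ D), ∏ e ∈ A.edges, (n e.2 : ℤ) := by
  rw [ncard_injectiveEmbeddedTrees hn]
  push_cast
  -- With no such tree both sides vanish. Otherwise a tree `A` gives every type an allowed parent,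
  -- so the truncated `card - 1` agrees with integer subtraction.
  rcases ((cayleyTrees ρ).filter fun A => A.edges ⊆ D).eq_empty_or_nonempty with h | ⟨A, hA⟩
  · simp [h]
  congr 1
  refine Finset.prod_congr rfl fun s _ => ?_
  have hA' : A.root = ρ ∧ A.edges ⊆ D := by simpa [cayleyTrees] using hA
  have hpos := Finset.card_pos.mpr (allowedParents_nonempty hn hA'.1 hA'.2 s)
  have hcast : ((if s = ρ then 1 else 0) - 1 +
      ∑ t ∈ Finset.univ.filter (fun t : Fin d => (s, t) ∈ D), (n t : ℤ)) =
        (((allowedParents n ρ D s).card - 1 : ℕ) : ℤ) := by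
    rw [Nat.cast_sub hpos, card_allowedParents]
    push_cast
    ring
  rw [hcast, Ring.choose_natCast, Nat.descFactorial_eq_factorial_mul_choose, Nat.cast_mul,
    mul_comm]
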